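/- Let $n\ge 0$ be an integer and let $\mathbb F_q$ be a finite field of characteristic different from $2$. Let $\mathfrak b$ be the algebra of upper triangular $n\times n$ matrices over $\mathbb F_q$, let $\mathfrak n\subset\mathfrak b$ be the subspace of strictly upper triangular matrices, and let $\mathfrak n^*$ be its dual space, on which $\mathfrak b$ acts by $(t\lambda)(x)=\lambda(xt)$ and $(\lambda t)(x)=\lambda(tx)$ for $t\in\mathfrak b$, $x\in\mathfrak n$, $\lambda\in\mathfrak n^*$. Let $\mathfrak g^a=\mathfrak b\oplus\mathfrak n^*$ be the associative algebra with multiplication $$(t_1+\lambda_1)(t_2+\lambda_2)=t_1t_2+t_1\lambda_2+\lambda_1t_2,$$ let $\mathfrak u=\mathfrak n+\mathfrak n^*\subset\mathfrak g^a$, and let $U^a=1+\mathfrak u$, a subgroup of the group of invertible elements of $\mathfrak g^a$. The superclass of $u=1+X\in U^a$ is the set $K(u)=1+U^aXU^a=\{1+aXb : a,b\in U^a\}$. Let $\Delta=\{(i,j): 1\le i,j\le n,\ i\ne j\}$ be the set of roots; $(i,j)$ is positive if $i<j$ and negative if $i>j$. For $i<j$ let $E_{ij}\in\mathfrak n$ be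 the matrix unit, and for $i>j$ let $F_{ij}\in\mathfrak n^*$ be the functional $F_{ij}(x)=x_{ji}$. A rook placement is a subset $D\subset\Delta$ that contains at most one root $(i,j)$ in each row $i$ and at most one in each column $j$. For a rook placement $D$ and a map $\phi:D\to\mathbb F_q^*$ put $$u_{D,\phi}=1+X_{D,\phi},\qquad X_{D,\phi}=\sum_{\substack{(i,j)\in D\\ i<j}}\phi(i,j)E_{ij}+\sum_{\substack{(i,j)\in D\\ i>j}}\phi(i,j)F_{ij}.$$ Then: 1. Each superclass of $U^a$ contains an element $u_{D,\phi}$ for some rook placement $D\subset\Delta$ and some map $\phi:D\to\mathbb F_q^*$. 2. Two elements $u_{D,\phi}$ and $u_{D',\phi'}$ (where $D,D'$ are rook placements, $\phi:D\to\mathbb F_q^*$ and $\phi':D'\to\mathbb F_q^*$) belong to a common superclass if and only if $(D,\phi)=(D',\phi')$. -/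

import Mathlib

namespace BorelContraction

/-- The associative algebra `𝔟` of upper triangular `n × n` matrices over `K`. -/
abbrev borel (n : ℕ) (K : Type*) [Field K] : Subalgebra K (Matrix (Fin n) (Fin n) K) :=
  Matrix.blockTriangularSubalgebra K K (id : Fin n → Fin n)

/-- The space `𝔫` of strictly upper triangular `n × n` matrices over `K`. -/
def nil (n : ℕ) (K : Type*) [Field K] : Submodule K (Matrix (Fin n) (Fin n) K) where
  carrier := {x | ∀ i j, j ≤ i → x i j = 0}
  zero_mem' := fun _ _ _ => rfl
  add_mem' := fun {a b} ha hb i j h => by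
    rw [Matrix.add_apply, ha i j h, hb i j h, add_zero]
  smul_mem' := fun c x hx i j h => by
    rw [Matrix.smul_apply, hx i j h, smul_zero]

section

variable {n : ℕ} {K : Type*} [Field K]

theorem mul_mem_nil_left {t x : Matrix (Fin n) (Fin n) K} (ht : t ∈ borel n K)
    (hx : x ∈ nil n K) : t * x ∈ nil n K := by
  intro i j hij
  rw [Matrix.mul_apply]
  refine Finset.sum_eq_zero fun k _ => ?_
  rcases lt_or_ge k i with h | h
  · rw [show t i k = 0 from ht h, zero_mul]
  · rw [hx k j (hij.trans h), mul_zero]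

theorem mul_mem_nil_right {t x : Matrix (Fin n) (Fin n) K} (ht : t ∈ borel n K)
    (hx : x ∈ nil n K) : x * t ∈ nil n K := by
  intro i j hij
  rw [Matrix.mul_apply]
  refine Finset.sum_eq_zero fun k _ => ?_
  rcases lt_or_ge j k with h | h
  · rw [show t k j = 0 from ht h, mul_zero]
  · rw [hx i k (h.trans hij), zero_mul]

/-- Left multiplication `x ↦ t x` on `𝔫` by `t ∈ 𝔟`. -/
def mulLeft (t : borel n K) : nil n K →ₗ[K] nil n K where
  toFun x := ⟨t * x, mul_mem_nil_left t.2 x.2⟩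
  map_add' _ _ := Subtype.ext (mul_add _ _ _)
  map_smul' _ _ := Subtype.ext (mul_smul_comm _ _ _)

/-- Right multiplication `x ↦ x t` on `𝔫` by `t ∈ 𝔟`. -/
def mulRight (t : borel n K) : nil n K →ₗ[K] nil n K where
  toFun x := ⟨x * t, mul_mem_nil_right t.2 x.2⟩
  map_add' _ _ := Subtype.ext (add_mul _ _ _)
  map_smul' _ _ := Subtype.ext (smul_mul_assoc _ _ _)

end

/-- The dual space `𝔫*`. -/
abbrev NilDual (n : ℕ) (K : Type*) [Field K] : Type _ := Module.Dual K (nil n K)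

section

variable {n : ℕ} {K : Type*} [Field K]

/-- The left action of `𝔟` on `𝔫*`: `(t λ)(x) = λ(x t)`. -/
instance leftModule : Module (borel n K) (NilDual n K) where
  smul t l := l ∘ₗ mulRight t
  one_smul l := LinearMap.ext fun _ => congrArg l (Subtype.ext (mul_one _))
  mul_smul _ _ l := LinearMap.ext fun _ => congrArg l (Subtype.ext (mul_assoc _ _ _).symm)
  smul_zero _ := rfl
  smul_add _ _ _ := rfl
  add_smul s t l := LinearMap.ext fun x =>
    (congrArg l (Subtype.ext (mul_add _ _ _) : mulRight (s + t) x = mulRight s x + mulRight t x)).trans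
      (map_add l _ _)
  zero_smul l := LinearMap.ext fun x =>
    (congrArg l (Subtype.ext (mul_zero _) : mulRight 0 x = 0)).trans (map_zero l)

/-- The right action of `𝔟` on `𝔫*`: `(λ t)(x) = λ(t x)`. -/
instance rightModule : Module (borel n K)ᵐᵒᵖ (NilDual n K) where
  smul t l := l ∘ₗ mulLeft t.unop
  one_smul l := LinearMap.ext fun _ => congrArg l (Subtype.ext (one_mul _))
  mul_smul _ _ l := LinearMap.ext fun _ => congrArg l (Subtype.ext (mul_assoc _ _ _))
  smul_zero _ := rfl
  smul_add _ _ _ := rfl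
  add_smul s t l := LinearMap.ext fun x =>
    (congrArg l (Subtype.ext (add_mul _ _ _) :
      mulLeft (s + t).unop x = mulLeft s.unop x + mulLeft t.unop x)).trans (map_add l _ _)
  zero_smul l := LinearMap.ext fun x =>
    (congrArg l (Subtype.ext (zero_mul _) : mulLeft 0 x = 0)).trans (map_zero l)

theorem smul_dual_apply (t : borel n K) (l : NilDual n K) (x : nil n K) :
    (t • l) x = l ⟨x * t, mul_mem_nil_right t.2 x.2⟩ := rfl

theorem op_smul_dual_apply (t : borel n K) (l : NilDual n K) (x : nil n K) :
    (MulOpposite.op t • l) x = l ⟨t * x, mul_mem_nil_left t.2 x.2⟩ := rfl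

instance bimodule : SMulCommClass (borel n K) (borel n K)ᵐᵒᵖ (NilDual n K) where
  smul_comm _ _ l := LinearMap.ext fun _ =>
    congrArg l (Subtype.ext (mul_assoc _ _ _).symm)

end

/-- The associative algebra `𝔤ᵃ = 𝔟 ⊕ 𝔫*` with the multiplication
`(t₁ + λ₁)(t₂ + λ₂) = t₁ t₂ + t₁ λ₂ + λ₁ t₂`. -/
abbrev ContractedAlgebra (n : ℕ) (K : Type*) [Field K] : Type _ :=
  TrivSqZeroExt (borel n K) (NilDual n K)

/-- The subspace `𝔲 = 𝔫 + 𝔫*` of `𝔤ᵃ`. -/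
def radical (n : ℕ) (K : Type*) [Field K] : Submodule K (ContractedAlgebra n K) where
  carrier := {X | (X.fst : Matrix (Fin n) (Fin n) K) ∈ nil n K}
  zero_mem' := (nil n K).zero_mem
  add_mem' := fun ha hb => (nil n K).add_mem ha hb
  smul_mem' := fun c _ hx => (nil n K).smul_mem c hx

section

variable {n : ℕ} {K : Type*} [Field K]

theorem mul_mem_radical_left (g : ContractedAlgebra n K) {X : ContractedAlgebra n K}
    (hX : X ∈ radical n K) : g * X ∈ radical n K :=
  mul_mem_nil_left g.fst.2 hX

theorem mul_mem_radical_right (g : ContractedAlgebra n K) {X : ContractedAlgebra n K}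
    (hX : X ∈ radical n K) : X * g ∈ radical n K :=
  mul_mem_nil_right g.fst.2 hX

theorem isUnit_one_add {X : ContractedAlgebra n K} (hX : X ∈ radical n K) : IsUnit (1 + X) := by
  rw [TrivSqZeroExt.isUnit_iff_isUnit_fst]
  set t : borel n K := (1 + X).fst with ht
  have hval : (t : Matrix (Fin n) (Fin n) K) = 1 + (X.fst : Matrix (Fin n) (Fin n) K) := rfl
  have hdet : (t : Matrix (Fin n) (Fin n) K).det = 1 := by
    rw [Matrix.det_of_isUpperTriangular t.2]
    refine Finset.prod_eq_one fun i _ => ?_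
    rw [hval, Matrix.add_apply, Matrix.one_apply_eq, hX i i le_rfl, add_zero]
  have hu : IsUnit (t : Matrix (Fin n) (Fin n) K).det := by rw [hdet]; exact isUnit_one
  let _ := Matrix.invertibleOfIsUnitDet _ hu
  have hinv : (t : Matrix (Fin n) (Fin n) K)⁻¹ ∈ borel n K :=
    Matrix.blockTriangular_inv_of_blockTriangular t.2
  exact ⟨⟨t, ⟨_, hinv⟩, Subtype.ext (Matrix.mul_nonsing_inv _ hu),
    Subtype.ext (Matrix.nonsing_inv_mul _ hu)⟩, rfl⟩

end

/-- The group `Uᵃ = 1 + 𝔲`, a subgroup of the group `Gᵃ` of invertible elements of `𝔤ᵃ`.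
Every `1 + X` with `X ∈ 𝔲` is invertible (`isUnit_one_add`), so that this is all of `1 + 𝔲`. -/
def Ua (n : ℕ) (K : Type*) [Field K] : Subgroup (ContractedAlgebra n K)ˣ where
  carrier := {g | (g : ContractedAlgebra n K) - 1 ∈ radical n K}
  one_mem' := by simp
  mul_mem' := fun {a b} ha hb => by
    have h : ((a * b : (ContractedAlgebra n K)ˣ) : ContractedAlgebra n K) - 1
        = a * ((b : ContractedAlgebra n K) - 1) + ((a : ContractedAlgebra n K) - 1) := by
      rw [Units.val_mul, mul_sub, mul_one, sub_add_sub_cancel]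
    change _ ∈ radical n K
    rw [h]
    exact (radical n K).add_mem (mul_mem_radical_left _ hb) ha
  inv_mem' := fun {a} ha => by
    have h : ((a⁻¹ : (ContractedAlgebra n K)ˣ) : ContractedAlgebra n K) - 1
        = -(((a⁻¹ : (ContractedAlgebra n K)ˣ) : ContractedAlgebra n K)
          * ((a : ContractedAlgebra n K) - 1)) := by
      rw [mul_sub, Units.inv_mul, mul_one, neg_sub]
    change _ ∈ radical n K
    rw [h]
    exact (radical n K).neg_mem (mul_mem_radical_left _ ha)

section

variable {n : ℕ} {K : Type*} [Field K]

/-- The underlying element of `𝔤ᵃ` of an element of `Uᵃ`. -/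
def toAlg (u : Ua n K) : ContractedAlgebra n K := u.1.1

/-- The element `1 + X` of `Uᵃ`, for `X ∈ 𝔲`. -/
noncomputable def oneAdd (X : ContractedAlgebra n K) (hX : X ∈ radical n K) : Ua n K :=
  ⟨(isUnit_one_add hX).unit, by
    change ((isUnit_one_add hX).unit : ContractedAlgebra n K) - 1 ∈ radical n K
    rw [IsUnit.unit_spec, add_sub_cancel_left]
    exact hX⟩

theorem toAlg_oneAdd (X : ContractedAlgebra n K) (hX : X ∈ radical n K) :
    toAlg (oneAdd X hX) = 1 + X := rfl

/-- The superclass `K(u) = 1 + Uᵃ X Uᵃ` of the element `u = 1 + X` of `Uᵃ`. -/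
def superclass (u : Ua n K) : Set (Ua n K) :=
  {v | ∃ a b : Ua n K, toAlg v = 1 + toAlg a * (toAlg u - 1) * toAlg b}

/-- A subset of `Uᵃ` is a superclass if it is the superclass of some element. -/
def IsSuperclass (C : Set (Ua n K)) : Prop := ∃ u : Ua n K, C = superclass u

end

/-- A root: a pair `(i, j)` with `i ≠ j`; it is positive if `i < j` and negative if `i > j`. -/
abbrev Root (n : ℕ) : Type := {α : Fin n × Fin n // α.1 ≠ α.2}

/-- The row number of a root. -/
def Root.row {n : ℕ} (α : Root n) : Fin n := α.1.1

/-- The column number of a root. -/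
def Root.col {n : ℕ} (α : Root n) : Fin n := α.1.2

/-- A rook placement: a set of roots with at most one root in any row and in any column. -/
structure RookPlacement (n : ℕ) where
  /-- The roots of the placement. -/
  roots : Finset (Root n)
  row_inj : ∀ α ∈ roots, ∀ β ∈ roots, Root.row α = Root.row β → α = β
  col_inj : ∀ α ∈ roots, ∀ β ∈ roots, Root.col α = Root.col β → α = β

section

variable {n : ℕ}

theorem single_mem_borel (K : Type*) [Field K] {i j : Fin n} (h : i < j) :
    Matrix.single i j (1 : K) ∈ borel n K :=
  Matrix.blockTriangular_single h.le 1

theorem single_mem_nil (K : Type*) [Field K] {i j : Fin n} (h : i < j) :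
    Matrix.single i j (1 : K) ∈ nil n K := by
  intro k l hkl
  refine Matrix.single_apply_of_ne _ _ _ _ _ ?_
  rintro ⟨rfl, rfl⟩
  exact absurd h hkl.not_gt

/-- The matrix unit `E_{ij} ∈ 𝔫`, for `i < j`, as an element of `𝔤ᵃ`. -/
def unitE (K : Type*) [Field K] (i j : Fin n) (h : i < j) : ContractedAlgebra n K :=
  TrivSqZeroExt.inl ⟨Matrix.single i j 1, single_mem_borel K h⟩

/-- The functional `x ↦ x_{ji}` on `𝔫`; for `i > j` it is the matrix unit of `𝔫₋ = 𝔫*`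
in position `(i, j)`, dual to `E_{ji}` under the trace form. -/
def coord (K : Type*) [Field K] (i j : Fin n) : NilDual n K where
  toFun x := (x : Matrix (Fin n) (Fin n) K) j i
  map_add' _ _ := rfl
  map_smul' _ _ := rfl

theorem coord_apply (K : Type*) [Field K] (i j : Fin n) (x : nil n K) :
    coord K i j x = (x : Matrix (Fin n) (Fin n) K) j i := rfl

/-- The matrix unit `F_{ij} ∈ 𝔫*` (used for `i > j`), as an element of `𝔤ᵃ`. -/
def unitF (K : Type*) [Field K] (i j : Fin n) : ContractedAlgebra n K :=
  TrivSqZeroExt.inr (coord K i j)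

/-- The basis vector of `𝔲` attached to a root: `E_α` if `α` is positive, `F_α` if `α` is
negative. -/
def rootVector (K : Type*) [Field K] (α : Root n) : ContractedAlgebra n K :=
  if h : α.row < α.col then unitE K α.row α.col h else unitF K α.row α.col

variable {K : Type*} [Field K]

theorem rootVector_mem (α : Root n) : rootVector K α ∈ radical n K := by
  unfold rootVector
  split_ifs with h
  · exact single_mem_nil K h
  · exact (nil n K).zero_mem

/-- The element `X_{D,φ} = ∑_{γ ∈ D₊} φ(γ) E_γ + ∑_{γ ∈ D₋} φ(γ) F_γ` of `𝔲`. -/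
def rookX (D : RookPlacement n) (φ : D.roots → Kˣ) : ContractedAlgebra n K :=
  ∑ γ : D.roots, (φ γ : K) • rootVector K γ.1

theorem rookX_mem (D : RookPlacement n) (φ : D.roots → Kˣ) : rookX D φ ∈ radical n K :=
  (radical n K).sum_mem fun γ _ => (radical n K).smul_mem _ (rootVector_mem γ.1)

/-- The element `u_{D,φ} = 1 + X_{D,φ}` of `Uᵃ`. -/
noncomputable def rookElement (D : RookPlacement n) (φ : D.roots → Kˣ) : Ua n K :=
  oneAdd (rookX D φ) (rookX_mem D φ)

end

end BorelContraction

/-!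
In the basis of matrix units, `𝔤ᵃ` is the algebra of `n × n` matrices with a truncated product:
`e_{ik} e_{kj} = e_{ij}` if `k` lies on the clockwise arc from `i` to `j` in the cyclic order of
the indices, and `e_{ik} e_{kj} = 0` otherwise. So multiplication by elements of `Uᵃ` performs row
and column operations which only lengthen the arcs of the entries. Pivoting on the entries in the
order of increasing arc length brings every element to a rook matrix. Conversely, if `a X = Y b`
with `a, b ∈ Uᵃ` and rook matrices `X`, `Y`, then for each nonzero entry of one of them the
other one has a nonzero entry in the same row with an arc that is at most as long; by symmetry the
arcs agree, and the values agree because `a` and `b` are unipotent.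
-/

namespace BorelContraction

section Arc

variable {n : ℕ}

/-- `k` lies on the clockwise arc from `i` to `j` in the cyclic order of `Fin n`. The length of
that arc is `j - i`, as the subtraction of `Fin n` is the one modulo `n`. -/
abbrev OnArc (i k j : Fin n) : Prop := k - i ≤ j - i

theorem onArc_left (i j : Fin n) : OnArc i i j := by
  fin_omega

theorem OnArc.antisymm {i j k : Fin n} (h : OnArc i k j) (h' : OnArc i j k) : k = j := by
  fin_omega

theorem onArc_iff_sub_le {i k j : Fin n} : OnArc i k j ↔ j - k ≤ j - i := by
  fin_omega

theorem onArc_iff_of_le {i k j : Fin n} (h : i ≤ j) : OnArc i k j ↔ i ≤ k ∧ k ≤ j := by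
  fin_omega

theorem onArc_iff_of_lt {i k j : Fin n} (h : j < i) : OnArc i k j ↔ i ≤ k ∨ k ≤ j := by
  fin_omega

end Arc

section RookMatrix

variable {m n R : Type*} [Zero R]

/-- The entry of `M` at `(i, j)` is nonzero, and it is the only such entry in its row and in its
column. -/
def IsIsolated (M : Matrix m n R) (i : m) (j : n) : Prop :=
  M i j ≠ 0 ∧ (∀ l ≠ j, M i l = 0) ∧ ∀ k ≠ i, M k j = 0

/-- A rook matrix: every row and every column has at most one nonzero entry. -/
def IsRookMatrix (M : Matrix m n R) : Prop := ∀ i j, M i j ≠ 0 → IsIsolated M i j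

theorem IsIsolated.congr {M N : Matrix m n R} {i : m} {j : n} (h : IsIsolated M i j)
    (hrow : ∀ l, N i l = M i l) (hcol : ∀ k, N k j = M k j) : IsIsolated N i j := by
  simpa only [IsIsolated, hrow, hcol] using h

end RookMatrix

section TwoSided

variable {M : Type*} [Monoid M] {U : Subgroup Mˣ} {x y z : M}

/-- `y` lies in the double coset `U x U` of a group `U` of units. -/
def TwoSidedAssociated (U : Subgroup Mˣ) (x y : M) : Prop :=
  ∃ a b : U, y = (a : Mˣ) * x * (b : Mˣ)

theorem TwoSidedAssociated.refl (U : Subgroup Mˣ) (x : M) : TwoSidedAssociated U x x :=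
  ⟨1, 1, by simp⟩

theorem TwoSidedAssociated.symm (h : TwoSidedAssociated U x y) : TwoSidedAssociated U y x := by
  obtain ⟨a, b, rfl⟩ := h
  exact ⟨a⁻¹, b⁻¹, by simp [mul_assoc]⟩

theorem TwoSidedAssociated.trans (h : TwoSidedAssociated U x y) (h' : TwoSidedAssociated U y z) :
    TwoSidedAssociated U x z := by
  obtain ⟨a, b, rfl⟩ := h
  obtain ⟨c, d, rfl⟩ := h'
  exact ⟨c * a, b * d, by simp [mul_assoc]⟩

theorem TwoSidedAssociated.exists_mul_eq_mul (h : TwoSidedAssociated U x y) :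
    ∃ a b : U, (a : Mˣ) * x = y * (b : Mˣ) := by
  obtain ⟨a, b, rfl⟩ := h
  exact ⟨a, b⁻¹, by simp⟩

end TwoSided

variable {n : ℕ} {K : Type*} [Field K]

section Entries

/-- The coordinates of an element of `𝔤ᵃ` in the basis of matrix units, as a full matrix: the
entries of the component in `𝔟` on and above the diagonal, and below it the coefficients of the
`F_{ij}` in the component in `𝔫*`. -/
def entries : ContractedAlgebra n K →ₗ[K] Matrix (Fin n) (Fin n) K where
  toFun X := Matrix.of fun i j =>
    if h : j < i then X.snd ⟨Matrix.single j i 1, single_mem_nil K h⟩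
    else (X.fst : Matrix (Fin n) (Fin n) K) i j
  map_add' X Y := by
    ext i j
    by_cases h : j < i <;> simp [h]
  map_smul' c X := by
    ext i j
    by_cases h : j < i <;> simp [h]

theorem entries_of_lt (X : ContractedAlgebra n K) {i j : Fin n} (h : j < i) :
    entries X i j = X.snd ⟨Matrix.single j i 1, single_mem_nil K h⟩ := dif_pos h

theorem entries_of_le (X : ContractedAlgebra n K) {i j : Fin n} (h : i ≤ j) :
    entries X i j = (X.fst : Matrix (Fin n) (Fin n) K) i j := dif_neg h.not_gt

theorem fst_apply (X : ContractedAlgebra n K) (i j : Fin n) :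
    (X.fst : Matrix (Fin n) (Fin n) K) i j = if i ≤ j then entries X i j else 0 := by
  split_ifs with h
  · exact (entries_of_le X h).symm
  · exact X.fst.2 (not_le.1 h)

theorem snd_apply_eq_trace (X : ContractedAlgebra n K) (x : nil n K) :
    X.snd x = ((x : Matrix (Fin n) (Fin n) K) * entries X).trace := by
  obtain ⟨f, hf⟩ := LinearMap.exists_extend X.snd
  have hsingle (i j : Fin n) :
      f (Matrix.single i j (x.1 i j)) = x.1 i j * entries X j i := by
    rcases lt_or_ge i j with h | h
    · rw [entries_of_lt X h, ← hf, LinearMap.comp_apply, Submodule.subtype_apply, ← smul_eq_mul,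
        ← map_smul, Matrix.smul_single, smul_eq_mul, mul_one]
    · rw [x.2 i j h, Matrix.single_zero, map_zero, zero_mul]
  calc X.snd x = f x.1 := by rw [← hf]; rfl
    _ = ∑ i, ∑ j, x.1 i j * entries X j i := by
      conv_lhs => rw [Matrix.matrix_eq_sum_single x.1]
      simp only [map_sum, hsingle]
    _ = (x.1 * entries X).trace := by simp only [Matrix.trace, Matrix.diag, Matrix.mul_apply]

theorem entries_injective : Function.Injective (entries (n := n) (K := K)) := by
  intro X Y h
  refine TrivSqZeroExt.ext (Subtype.ext (Matrix.ext fun i j => ?_)) (LinearMap.ext fun x => ?_)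
  · rw [fst_apply, fst_apply, h]
  · rw [snd_apply_eq_trace, snd_apply_eq_trace, h]

theorem entries_inl (t : borel n K) : entries (TrivSqZeroExt.inl t) = t.1 := by
  ext i j
  rcases lt_or_ge j i with h | h
  · rw [entries_of_lt _ h, TrivSqZeroExt.snd_inl, LinearMap.zero_apply, t.2 h]
  · rw [entries_of_le _ h, TrivSqZeroExt.fst_inl]

theorem entries_inr_of_lt (l : NilDual n K) {i j : Fin n} (h : j < i) :
    entries (TrivSqZeroExt.inr l) i j = l ⟨Matrix.single j i 1, single_mem_nil K h⟩ := by
  rw [entries_of_lt _ h, TrivSqZeroExt.snd_inr]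

theorem entries_inr_of_le (l : NilDual n K) {i j : Fin n} (h : i ≤ j) :
    entries (TrivSqZeroExt.inr l) i j = 0 := by
  rw [entries_of_le _ h, TrivSqZeroExt.fst_inr, ZeroMemClass.coe_zero, Matrix.zero_apply]

theorem entries_surjective : Function.Surjective (entries (n := n) (K := K)) := by
  intro M
  let t : borel n K := ⟨Matrix.of fun i j => if i ≤ j then M i j else 0,
    fun i j (h : j < i) => if_neg h.not_ge⟩
  let l : NilDual n K :=
    Matrix.traceLinearMap (Fin n) K K ∘ₗ LinearMap.mulRight K M ∘ₗ (nil n K).subtype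
  refine ⟨TrivSqZeroExt.inl t + TrivSqZeroExt.inr l, Matrix.ext fun i j => ?_⟩
  rw [map_add, Matrix.add_apply, entries_inl]
  rcases lt_or_ge j i with h | h
  · rw [entries_inr_of_lt _ h]
    simp [t, l, h, Matrix.trace_single_mul]
  · rw [entries_inr_of_le _ h]
    simp [t, h]

theorem entries_mul (X Y : ContractedAlgebra n K) (i j : Fin n) :
    entries (X * Y) i j = ∑ k with OnArc i k j, entries X i k * entries Y k j := by
  rw [Finset.sum_filter]
  rcases lt_or_ge j i with hij | hij
  · have hsnd : entries (X * Y) i j = (X.fst.1 * entries Y) i j + (entries X * Y.fst.1) i j := by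
      rw [entries_of_lt _ hij, TrivSqZeroExt.snd_mul, LinearMap.add_apply, smul_dual_apply,
        op_smul_dual_apply, snd_apply_eq_trace, snd_apply_eq_trace, mul_assoc,
        Matrix.trace_single_mul, Matrix.trace_mul_cycle, Matrix.trace_mul_single, one_smul,
        MulOpposite.op_one, one_smul]
    rw [hsnd, Matrix.mul_apply, Matrix.mul_apply, ← Finset.sum_add_distrib]
    refine Finset.sum_congr rfl fun k _ => ?_
    simp only [onArc_iff_of_lt hij, fst_apply]
    by_cases hik : i ≤ k
    · simp [hik, (hij.trans_le hik).not_ge]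
    · simp [hik]
  · rw [entries_of_le _ hij, TrivSqZeroExt.fst_mul, MulMemClass.coe_mul, Matrix.mul_apply]
    refine Finset.sum_congr rfl fun k _ => ?_
    simp only [onArc_iff_of_le hij, fst_apply, ite_zero_mul_ite_zero]

theorem entries_mul_of_col (X Y : ContractedAlgebra n K) {i j : Fin n}
    (h : ∀ k ≠ i, entries Y k j = 0) :
    entries (X * Y) i j = entries X i i * entries Y i j := by
  rw [entries_mul]
  refine Finset.sum_eq_single_of_mem i (by simp [onArc_left]) fun k _ hk => ?_
  rw [h k hk, mul_zero]

theorem entries_mul_of_row (X Y : ContractedAlgebra n K) {i j : Fin n}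
    (h : ∀ k ≠ j, entries X i k = 0) :
    entries (X * Y) i j = entries X i j * entries Y j j := by
  rw [entries_mul]
  refine Finset.sum_eq_single_of_mem j (by simp) fun k _ hk => ?_
  rw [h k hk, zero_mul]

theorem mem_radical_iff (X : ContractedAlgebra n K) :
    X ∈ radical n K ↔ ∀ i, entries X i i = 0 := by
  simp only [entries_of_le _ le_rfl]
  refine ⟨fun h i => h i i le_rfl, fun h i j hij => ?_⟩
  rcases hij.lt_or_eq with hij | rfl
  · exact X.fst.2 hij
  · exact h j

theorem entries_toAlg_apply_self (u : Ua n K) (i : Fin n) : entries (toAlg u) i i = 1 := by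
  have hone : entries (1 : ContractedAlgebra n K) = 1 := entries_inl 1
  have hsub : entries (toAlg u - 1) i i = 0 := (mem_radical_iff _).1 u.2 i
  rwa [map_sub, Matrix.sub_apply, hone, Matrix.one_apply_eq, sub_eq_zero] at hsub

theorem TwoSidedAssociated.mem_radical {X Y : ContractedAlgebra n K}
    (h : TwoSidedAssociated (Ua n K) X Y) (hX : X ∈ radical n K) : Y ∈ radical n K := by
  obtain ⟨a, b, rfl⟩ := h
  exact mul_mem_radical_right _ (mul_mem_radical_left _ hX)

end Entries

section Reduction

theorem exists_column_operation (X : ContractedAlgebra n K) (j : Fin n) {v : Fin n → K}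
    (hv : v j = 0) :
    ∃ Y, TwoSidedAssociated (Ua n K) X Y ∧ ∀ k l,
      entries Y k l = entries X k l + if OnArc k j l then entries X k j * v l else 0 := by
  obtain ⟨Z, hZ⟩ := entries_surjective (Matrix.updateRow 0 j v)
  have hZrad : Z ∈ radical n K := by
    rw [mem_radical_iff, hZ]
    intro k
    rcases eq_or_ne k j with rfl | hk
    · rwa [Matrix.updateRow_self]
    · rw [Matrix.updateRow_ne hk, Matrix.zero_apply]
  refine ⟨X * (1 + Z), ⟨1, oneAdd Z hZrad, (congrArg (· * (1 + Z)) (one_mul X)).symm⟩,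
    fun k l => ?_⟩
  rw [mul_add, mul_one, map_add, Matrix.add_apply, entries_mul, Finset.sum_filter, hZ,
    Finset.sum_eq_single j (fun m _ hm => by simp [Matrix.updateRow_ne hm]) (by simp),
    Matrix.updateRow_self]

theorem exists_row_operation (X : ContractedAlgebra n K) (i : Fin n) {v : Fin n → K}
    (hv : v i = 0) :
    ∃ Y, TwoSidedAssociated (Ua n K) X Y ∧ ∀ k l,
      entries Y k l = entries X k l + if OnArc k i l then v k * entries X i l else 0 := by
  obtain ⟨Z, hZ⟩ := entries_surjective (Matrix.updateCol 0 i v)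
  have hZrad : Z ∈ radical n K := by
    rw [mem_radical_iff, hZ]
    intro k
    rcases eq_or_ne k i with rfl | hk
    · rwa [Matrix.updateCol_self]
    · rw [Matrix.updateCol_ne hk, Matrix.zero_apply]
  refine ⟨(1 + Z) * X, ⟨oneAdd Z hZrad, 1, (mul_one ((1 + Z) * X)).symm⟩, fun k l => ?_⟩
  rw [add_mul, one_mul, map_add, Matrix.add_apply, entries_mul, Finset.sum_filter, hZ,
    Finset.sum_eq_single i (fun m _ hm => by simp [Matrix.updateCol_ne hm]) (by simp),
    Matrix.updateCol_self]

theorem exists_clear_row (X : ContractedAlgebra n K) {i j : Fin n} (hij : entries X i j ≠ 0)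
    (hrow : ∀ l, entries X i l ≠ 0 → OnArc i j l) :
    ∃ Y, TwoSidedAssociated (Ua n K) X Y ∧ (∀ l ≠ j, entries Y i l = 0) ∧
      (∀ k, entries Y k j = entries X k j) ∧
      ∀ k l, entries X k j = 0 ∨ entries X i l = 0 → entries Y k l = entries X k l := by
  obtain ⟨Y, hXY, hY⟩ := exists_column_operation X j
    (v := Function.update (fun l => -(entries X i l / entries X i j)) j 0)
    (Function.update_self ..)
  refine ⟨Y, hXY, fun l hl => ?_, fun k => by simp [hY], fun k l h => ?_⟩
  · rw [hY, Function.update_of_ne hl, mul_neg, mul_div_cancel₀ _ hij]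
    by_cases h : entries X i l = 0
    · simp [h]
    · rw [if_pos (hrow l h), add_neg_cancel]
  · rw [hY]
    rcases eq_or_ne l j with rfl | hl
    · simp
    · rw [Function.update_of_ne hl]
      rcases h with h | h <;> simp [h]

theorem exists_clear_col (X : ContractedAlgebra n K) {i j : Fin n} (hij : entries X i j ≠ 0)
    (hcol : ∀ k, entries X k j ≠ 0 → OnArc k i j) :
    ∃ Y, TwoSidedAssociated (Ua n K) X Y ∧ (∀ k ≠ i, entries Y k j = 0) ∧
      (∀ l, entries Y i l = entries X i l) ∧
      ∀ k l, entries X k j = 0 ∨ entries X i l = 0 → entries Y k l = entries X k l := by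
  obtain ⟨Y, hXY, hY⟩ := exists_row_operation X i
    (v := Function.update (fun k => -(entries X k j / entries X i j)) i 0)
    (Function.update_self ..)
  refine ⟨Y, hXY, fun k hk => ?_, fun l => by simp [hY], fun k l h => ?_⟩
  · rw [hY, Function.update_of_ne hk, neg_mul, div_mul_cancel₀ _ hij]
    by_cases h : entries X k j = 0
    · simp [h]
    · rw [if_pos (hcol k h), add_neg_cancel]
  · rw [hY]
    rcases eq_or_ne k i with rfl | hk
    · simp
    · rw [Function.update_of_ne hk]
      rcases h with h | h <;> simp [h]

theorem exists_isIsolated (X : ContractedAlgebra n K) {i j : Fin n} (hij : entries X i j ≠ 0)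
    (hrow : ∀ l, entries X i l ≠ 0 → OnArc i j l) (hcol : ∀ k, entries X k j ≠ 0 → OnArc k i j) :
    ∃ Y, TwoSidedAssociated (Ua n K) X Y ∧ IsIsolated (entries Y) i j ∧
      ∀ k l, IsIsolated (entries X) k l → k ≠ i → l ≠ j → IsIsolated (entries Y) k l := by
  obtain ⟨Y, hXY, hYrow, hYcol, hY⟩ := exists_clear_row X hij hrow
  obtain ⟨Z, hYZ, hZcol, hZrow, hZ⟩ := exists_clear_col Y (by rwa [hYcol])
    fun k hk => hcol k (by rwa [← hYcol])
  refine ⟨Z, hXY.trans hYZ, ⟨?_, fun l hl => ?_, hZcol⟩, fun k l hkl hk hl => ?_⟩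
  · rwa [hZrow, hYcol]
  · rw [hZrow, hYrow l hl]
  · have hkj : entries X k j = 0 := hkl.2.1 j hl.symm
    have hil : entries X i l = 0 := hkl.2.2 i hk.symm
    refine hkl.congr (fun m => ?_) fun m => ?_
    · rw [hZ k m (.inl (by rwa [hYcol])), hY k m (.inl hkj)]
    · rw [hZ m l (.inr (hYrow l hl)), hY m l (.inr hil)]

theorem exists_shortest_not_isIsolated {R : Type*} [Zero R] {M : Matrix (Fin n) (Fin n) R}
    (hM : ¬ IsRookMatrix M) :
    ∃ i j, M i j ≠ 0 ∧ ¬ IsIsolated M i j ∧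
      ∀ k l, M k l ≠ 0 → ¬ IsIsolated M k l → j - i ≤ l - k := by
  classical
  let S : Finset (Fin n × Fin n) := {p | M p.1 p.2 ≠ 0 ∧ ¬ IsIsolated M p.1 p.2}
  have hS : S.Nonempty := by
    simp only [IsRookMatrix, not_forall] at hM
    obtain ⟨i, j, hij, h⟩ := hM
    exact ⟨(i, j), by simp [S, hij, h]⟩
  obtain ⟨⟨i, j⟩, hp, hmin⟩ := S.exists_min_image (fun p => p.2 - p.1) hS
  obtain ⟨hij, h⟩ : M i j ≠ 0 ∧ ¬ IsIsolated M i j := by simpa [S] using hp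
  exact ⟨i, j, hij, h, fun k l hkl h' => hmin (k, l) (by simp [S, hkl, h'])⟩

theorem exists_more_isIsolated {X : ContractedAlgebra n K} (hX : ¬ IsRookMatrix (entries X)) :
    ∃ Y, TwoSidedAssociated (Ua n K) X Y ∧
      {p : Fin n × Fin n | IsIsolated (entries X) p.1 p.2} ⊂
        {p | IsIsolated (entries Y) p.1 p.2} := by
  obtain ⟨i, j, hij, hni, hmin⟩ := exists_shortest_not_isIsolated hX
  have hrow (l : Fin n) (hl : entries X i l ≠ 0) : ¬ IsIsolated (entries X) i l := by
    intro h
    rcases eq_or_ne j l with rfl | hjl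
    · exact hni h
    · exact hij (h.2.1 j hjl)
  have hcol (k : Fin n) (hk : entries X k j ≠ 0) : ¬ IsIsolated (entries X) k j := by
    intro h
    rcases eq_or_ne i k with rfl | hik
    · exact hni h
    · exact hij (h.2.2 i hik)
  obtain ⟨Y, hXY, hYij, hY⟩ := exists_isIsolated X hij (fun l hl => hmin i l hl (hrow l hl))
    fun k hk => onArc_iff_sub_le.2 (hmin k j hk (hcol k hk))
  refine ⟨Y, hXY, Set.ssubset_iff_of_subset ?_ |>.2 ⟨(i, j), hYij, hni⟩⟩
  rintro ⟨k, l⟩ hkl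
  refine hY k l hkl ?_ ?_
  · rintro rfl
    exact hrow l hkl.1 hkl
  · rintro rfl
    exact hcol k hkl.1 hkl

theorem exists_isRookMatrix (X : ContractedAlgebra n K) :
    ∃ Y, TwoSidedAssociated (Ua n K) X Y ∧ IsRookMatrix (entries Y) := by
  induction hS : {p : Fin n × Fin n | IsIsolated (entries X) p.1 p.2} using
    WellFoundedGT.induction generalizing X with
  | ind S ih =>
    subst hS
    by_cases hX : IsRookMatrix (entries X)
    · exact ⟨X, .refl _ X, hX⟩
    · obtain ⟨Y, hXY, hlt⟩ := exists_more_isIsolated hX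
      obtain ⟨Z, hYZ, hZ⟩ := ih _ hlt Y rfl
      exact ⟨Z, hXY.trans hYZ, hZ⟩

end Reduction

section Uniqueness

variable {X Y : ContractedAlgebra n K} {i j : Fin n}

theorem IsIsolated.exists_onArc (hX : IsIsolated (entries X) i j)
    (h : TwoSidedAssociated (Ua n K) X Y) : ∃ l, OnArc i l j ∧ entries Y i l ≠ 0 := by
  obtain ⟨a, b, hab⟩ := h.exists_mul_eq_mul
  have hsum : ∑ l with OnArc i l j, entries Y i l * entries (toAlg b) l j ≠ 0 := by
    calc ∑ l with OnArc i l j, entries Y i l * entries (toAlg b) l j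
        = entries (Y * toAlg b) i j := (entries_mul ..).symm
      _ = entries (toAlg a * X) i j := congrArg (entries · i j) hab.symm
      _ = entries X i j := by
        rw [entries_mul_of_col _ _ hX.2.2, entries_toAlg_apply_self, one_mul]
      _ ≠ 0 := hX.1
  obtain ⟨l, hl, hne⟩ := Finset.exists_ne_zero_of_sum_ne_zero hsum
  exact ⟨l, (Finset.mem_filter.1 hl).2, left_ne_zero_of_mul hne⟩

theorem IsIsolated.entries_eq (hX : IsIsolated (entries X) i j) (hY : IsIsolated (entries Y) i j)
    (h : TwoSidedAssociated (Ua n K) X Y) : entries X i j = entries Y i j := by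
  obtain ⟨a, b, hab⟩ := h.exists_mul_eq_mul
  calc entries X i j = entries (toAlg a * X) i j := by
        rw [entries_mul_of_col _ _ hX.2.2, entries_toAlg_apply_self, one_mul]
    _ = entries (Y * toAlg b) i j := congrArg (entries · i j) hab
    _ = entries Y i j := by
        rw [entries_mul_of_row _ _ hY.2.1, entries_toAlg_apply_self, mul_one]

theorem IsRookMatrix.entries_eq (hX : IsRookMatrix (entries X)) (hY : IsRookMatrix (entries Y))
    (h : TwoSidedAssociated (Ua n K) X Y) (hij : entries X i j ≠ 0) :
    entries X i j = entries Y i j := by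
  obtain ⟨l, hl, hYl⟩ := (hX i j hij).exists_onArc h
  obtain ⟨m, hm, hXm⟩ := (hY i l hYl).exists_onArc h.symm
  obtain rfl : m = j := not_imp_comm.1 ((hX i j hij).2.1 m) hXm
  obtain rfl : l = m := hl.antisymm hm
  exact (hX i l hij).entries_eq (hY i l hYl) h

theorem IsRookMatrix.eq_of_twoSidedAssociated (hX : IsRookMatrix (entries X))
    (hY : IsRookMatrix (entries Y)) (h : TwoSidedAssociated (Ua n K) X Y) : X = Y := by
  refine entries_injective (Matrix.ext fun i j => ?_)
  by_cases hij : entries X i j = 0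
  · by_contra hne
    exact hne (hY.entries_eq hX h.symm (hij ▸ Ne.symm hne)).symm
  · exact hX.entries_eq hY h hij

end Uniqueness

section Rook

theorem entries_rootVector (α : Root n) :
    entries (rootVector K α) = Matrix.single α.row α.col 1 := by
  unfold rootVector
  split_ifs with h
  · exact entries_inl _
  · have hα : α.col < α.row := lt_of_le_of_ne (not_lt.1 h) α.2.symm
    ext i j
    rcases lt_or_ge j i with hij | hij
    · simp only [unitF, entries_inr_of_lt _ hij, coord_apply, Matrix.single_apply, and_comm,
        eq_comm]
    · rw [unitF, entries_inr_of_le _ hij, Matrix.single_apply_of_ne]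
      rintro ⟨rfl, rfl⟩
      exact hij.not_gt hα

theorem entries_rookX (D : RookPlacement n) (φ : D.roots → Kˣ) :
    entries (rookX D φ) = ∑ γ : D.roots, Matrix.single γ.1.row γ.1.col (φ γ : K) := by
  simp only [rookX, map_sum, map_smul, entries_rootVector, Matrix.smul_single, smul_eq_mul, mul_one]

theorem entries_rookX_root (D : RookPlacement n) (φ : D.roots → Kˣ) (γ : D.roots) :
    entries (rookX D φ) γ.1.row γ.1.col = φ γ := by
  rw [entries_rookX, Matrix.sum_apply, Finset.sum_eq_single γ, Matrix.single_apply_same]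
  · intro β _ hβ
    refine Matrix.single_apply_of_ne _ _ _ _ _ fun h => hβ ?_
    exact Subtype.ext (D.row_inj _ β.2 _ γ.2 h.1)
  · simp

theorem exists_root_of_entries_rookX_ne_zero {D : RookPlacement n} {φ : D.roots → Kˣ}
    {i j : Fin n} (h : entries (rookX D φ) i j ≠ 0) :
    ∃ γ ∈ D.roots, γ.row = i ∧ γ.col = j := by
  rw [entries_rookX, Matrix.sum_apply] at h
  obtain ⟨γ, -, hγ⟩ := Finset.exists_ne_zero_of_sum_ne_zero h
  exact ⟨γ, γ.2, not_imp_comm.1 (Matrix.single_apply_of_ne _ _ _ _ _) hγ⟩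

theorem mem_roots_iff {D : RookPlacement n} (φ : D.roots → Kˣ) {α : Root n} :
    α ∈ D.roots ↔ entries (rookX D φ) α.row α.col ≠ 0 := by
  refine ⟨fun hα => ?_, fun h => ?_⟩
  · rw [entries_rookX_root D φ ⟨α, hα⟩]
    exact (φ _).ne_zero
  · obtain ⟨γ, hγ, hr, hc⟩ := exists_root_of_entries_rookX_ne_zero h
    obtain rfl : γ = α := Subtype.ext (Prod.ext hr hc)
    exact hγ

theorem isRookMatrix_rookX (D : RookPlacement n) (φ : D.roots → Kˣ) :
    IsRookMatrix (entries (rookX D φ)) := by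
  intro i j h
  obtain ⟨γ, hγ, rfl, rfl⟩ := exists_root_of_entries_rookX_ne_zero h
  refine ⟨h, fun l hl => by_contra fun hne => ?_, fun k hk => by_contra fun hne => ?_⟩
  · obtain ⟨β, hβ, hr, rfl⟩ := exists_root_of_entries_rookX_ne_zero hne
    exact hl (by rw [D.row_inj β hβ γ hγ hr])
  · obtain ⟨β, hβ, rfl, hc⟩ := exists_root_of_entries_rookX_ne_zero hne
    exact hk (by rw [D.col_inj β hβ γ hγ hc])

theorem IsRookMatrix.exists_rookPlacement {R : Type*} [Zero R] {M : Matrix (Fin n) (Fin n) R}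
    (hM : IsRookMatrix M) :
    ∃ D : RookPlacement n, ∀ α, α ∈ D.roots ↔ M α.row α.col ≠ 0 := by
  classical
  refine ⟨⟨{α | M α.row α.col ≠ 0}, fun α hα β hβ h => ?_, fun α hα β hβ h => ?_⟩, by simp⟩ <;>
    simp only [Finset.mem_filter, Finset.mem_univ, true_and] at hα hβ
  · have hcol : β.col = α.col := not_imp_comm.1 ((hM _ _ hα).2.1 β.col) (h ▸ hβ)
    exact Subtype.ext (Prod.ext h hcol.symm)
  · have hrow : β.row = α.row := not_imp_comm.1 ((hM _ _ hα).2.2 β.row) (h ▸ hβ)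
    exact Subtype.ext (Prod.ext hrow.symm h)

theorem IsRookMatrix.exists_eq_rookX {X : ContractedAlgebra n K} (h : IsRookMatrix (entries X))
    (hX : X ∈ radical n K) : ∃ (D : RookPlacement n) (φ : D.roots → Kˣ), X = rookX D φ := by
  obtain ⟨D, hD⟩ := h.exists_rookPlacement
  let φ (γ : D.roots) : Kˣ := Units.mk0 _ ((hD γ).1 γ.2)
  refine ⟨D, φ, entries_injective (Matrix.ext fun i j => ?_)⟩
  rcases eq_or_ne i j with rfl | hij
  · rw [(mem_radical_iff X).1 hX, (mem_radical_iff _).1 (rookX_mem D φ)]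
  by_cases hα : ⟨(i, j), hij⟩ ∈ D.roots
  · exact (entries_rookX_root D φ ⟨_, hα⟩).symm
  · have hzero : entries X i j = 0 := not_not.1 ((hD ⟨(i, j), hij⟩).not.1 hα)
    rw [hzero]
    exact (not_not.1 ((mem_roots_iff φ).not.1 hα)).symm

theorem sigma_eq_of_rookX_eq {D D' : RookPlacement n} {φ : D.roots → Kˣ} {φ' : D'.roots → Kˣ}
    (h : rookX D φ = rookX D' φ') :
    (⟨D, φ⟩ : (E : RookPlacement n) × (E.roots → Kˣ)) = ⟨D', φ'⟩ := by
  have hroots : D.roots = D'.roots := by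
    ext α
    rw [mem_roots_iff φ, mem_roots_iff φ', h]
  obtain rfl : D = D' := by
    cases D
    cases D'
    congr
  congr 1
  funext γ
  rw [Units.ext_iff, ← entries_rookX_root D φ γ, ← entries_rookX_root D φ' γ, h]

end Rook

section Superclass

theorem rookElement_mem_superclass_iff (D : RookPlacement n) (φ : D.roots → Kˣ) (u : Ua n K) :
    rookElement D φ ∈ superclass u ↔ TwoSidedAssociated (Ua n K) (toAlg u - 1) (rookX D φ) :=
  exists₂_congr fun _ _ => add_right_inj (1 : ContractedAlgebra n K)

theorem rookElement_mem_superclass_self (D : RookPlacement n) (φ : D.roots → Kˣ) :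
    rookElement D φ ∈ superclass (rookElement D φ) := by
  rw [rookElement_mem_superclass_iff, rookElement, toAlg_oneAdd, add_sub_cancel_left]
  exact .refl _ _

end Superclass

end BorelContraction

open BorelContraction in
theorem theorem3p4_general (n : ℕ) (K : Type*) [Field K] :
    (∀ C : Set (Ua n K), IsSuperclass C →
      ∃ (D : RookPlacement n) (φ : D.roots → Kˣ), rookElement D φ ∈ C) ∧
    (∀ (D : RookPlacement n) (φ : D.roots → Kˣ) (D' : RookPlacement n) (φ' : D'.roots → Kˣ),
      (∃ C : Set (Ua n K), IsSuperclass C ∧ rookElement D φ ∈ C ∧ rookElement D' φ' ∈ C) ↔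
      (⟨D, φ⟩ : (E : RookPlacement n) × (E.roots → Kˣ)) = ⟨D', φ'⟩) := by
  refine ⟨?_, fun D φ D' φ' => ⟨?_, fun h => ?_⟩⟩
  · rintro C ⟨u, rfl⟩
    obtain ⟨Y, hY, hrook⟩ := exists_isRookMatrix (toAlg u - 1)
    obtain ⟨D, φ, rfl⟩ := hrook.exists_eq_rookX (hY.mem_radical u.2)
    exact ⟨D, φ, (rookElement_mem_superclass_iff D φ u).2 hY⟩
  · rintro ⟨C, ⟨u, rfl⟩, h, h'⟩
    rw [rookElement_mem_superclass_iff] at h h'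
    exact sigma_eq_of_rookX_eq ((isRookMatrix_rookX D φ).eq_of_twoSidedAssociated
      (isRookMatrix_rookX D' φ') (h.symm.trans h'))
  · cases h
    have hmem := rookElement_mem_superclass_self D φ
    exact ⟨_, ⟨_, rfl⟩, hmem, hmem⟩

theorem theorem3p4 (n : ℕ) (K : Type*) [Field K] [Finite K] (hK : ringChar K ≠ 2) :
    (∀ C : Set (BorelContraction.Ua n K), BorelContraction.IsSuperclass C →
      ∃ (D : BorelContraction.RookPlacement n) (φ : D.roots → Kˣ),
        BorelContraction.rookElement D φ ∈ C) ∧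
    (∀ (D : BorelContraction.RookPlacement n) (φ : D.roots → Kˣ)
      (D' : BorelContraction.RookPlacement n) (φ' : D'.roots → Kˣ),
      (∃ C : Set (BorelContraction.Ua n K), BorelContraction.IsSuperclass C ∧
        BorelContraction.rookElement D φ ∈ C ∧ BorelContraction.rookElement D' φ' ∈ C) ↔
      (⟨D, φ⟩ : (E : BorelContraction.RookPlacement n) × (E.roots → Kˣ)) = ⟨D', φ'⟩) :=
  theorem3p4_general n K
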